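/- Let $p$ be a prime number, $d\ge 1$ and $q=p^d$. All groups are profinite, subgroups are closed and homomorphisms are continuous. For a profinite group $G$ let $H^r(G)=H^r(G,\mathbb{Z}/q)$ be the continuous cohomology with trivial action on $\mathbb{Z}/q$, and let $H^*(G)=\bigoplus_{r\ge0}H^r(G)$ be the graded cohomology ring with the cup product. Define the descending $q$-central sequence of $G$ by $G^{(1)}=G$ and by letting $G^{(i+1)}$ be the closed subgroup topologically generated by all $h^q$ and all $[h,g]=h^{-1}g^{-1}hg$ with $h\in G^{(i)}$, $g\in G$. Let $G(p)$ be the maximal pro-$p$ quotient of $G$. For a graded-commutative $R$-algebra $\mathcal{A}=\bigoplus_{r\ge0}A_r$ with $A_0=R$, let $A_{\mathrm{dec},r}\subseteq A_r$ be the $R$-submodule generated by all products of $r$ elements of $A_1$ (with $A_{\mathrm{dec},0}=R$), and let $\mathcal{A}_{\mathrm{dec}}=\bigoplus_r A_{\mathrm{dec},r}$; $A_r$ is decomposable if $A_r=A_{\mathrm{dec},r}$. Let $T_r\subseteq A_1^{\otimes r}$ be the submodule generated by all tensors $a_1\otimes\cdots\otimes a_r$ such that $a_ia_j=0$ in $A_2$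 for some distinct $i,j$ (with $A_1^{\otimes0}=R$, $T_0=0$). Multiplication induces an epimorphism of graded $R$-algebras $\omega_{\mathcal{A}}\colon\bigoplus_r A_1^{\otimes r}/T_r\to\mathcal{A}_{\mathrm{dec}}$, and $\mathcal{A}$ is called quadratic if $\omega_{\mathcal{A}}$ is an isomorphism. These notions are applied to $\mathcal{A}=H^*(G)$, $R=\mathbb{Z}/q$. **Theorem.** Let $G$ be a profinite group with $H^*(G)$ quadratic, and let $N$ be a closed normal subgroup of $G$ with $N\le G^{(3)}$. Then: (a) the inflation map $\inf_G\colon H^*(G/N)_{\mathrm{dec}}\to H^*(G)_{\mathrm{dec}}$ is an isomorphism; (b) $H^*(G/N)$ is quadratic; (c) if $H^2(G/N)$ is decomposable, then $N$ is contained in the kernel of the canonical map $G\to G(p)$. -/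

import Mathlib

open scoped DirectSum TensorProduct

noncomputable section

universe u v w

/-! ## Graded algebras: decomposable part, quadratic hull, quadratic algebras -/

namespace GradedAlg

section Defs

variable (R : Type v) [CommRing R] (A : ℕ → Type w) [∀ r, AddCommGroup (A r)]
  [∀ r, Module R (A r)] [DirectSum.GRing A] [DirectSum.GAlgebra R A]

/-- The component `A_{dec,r}`: the submodule of `A_r` generated by all products of `r` elements
of `A_1` (the empty product being `1`). -/
def decPart (r : ℕ) : Submodule R (A r) :=
  Submodule.span R {x | ∃ a : Fin r → A 1,
    DirectSum.of A r x = (List.ofFn fun i => DirectSum.of A 1 (a i)).prod}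

/-- `A_r` is decomposable if `A_r = A_{dec,r}`. -/
def IsDecomposable (r : ℕ) : Prop := decPart R A r = ⊤

/-- The decomposable part `A_dec` of `⨁ r, A_r`: the subalgebra generated by `A_1`. -/
def dec : Subalgebra R (⨁ r, A r) :=
  Algebra.adjoin R (Set.range fun a : A 1 => DirectSum.of A 1 a)

/-- The submodule `T_r` of `A_1^{⊗ r}` generated by all tensors `a_1 ⊗ ⋯ ⊗ a_r` such that
`a_i a_j = 0` in `A_2` for some distinct `i`, `j`. -/
def hullRel (r : ℕ) : Submodule R (⨂[R]^r (A 1)) :=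
  Submodule.span R {t | ∃ a : Fin r → A 1,
    (∃ i j : Fin r, i ≠ j ∧ GradedMonoid.GMul.mul (a i) (a j) = 0) ∧
      t = PiTensorProduct.tprod R a}

/-- The degree `r` component `A_1^{⊗ r} / T_r` of the quadratic hull. -/
abbrev Hull (r : ℕ) := (⨂[R]^r (A 1)) ⧸ hullRel R A r

/-- Elements of degree one anticommute, as in any graded-commutative algebra. -/
class DegreeOneAnticomm (A : ℕ → Type w) [∀ r, AddCommGroup (A r)] [DirectSum.GRing A] :
    Prop where
  anticomm : ∀ a b : A 1, GradedMonoid.GMul.mul a b = -GradedMonoid.GMul.mul b a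

/-- The multiplication map `A_1^{⊗ r} → A`, `a_1 ⊗ ⋯ ⊗ a_r ↦ a_1 ⋯ a_r`. -/
def tensorMul (r : ℕ) : (⨂[R]^r (A 1)) →ₗ[R] ⨁ r, A r :=
  PiTensorProduct.lift ((MultilinearMap.mkPiAlgebraFin R r (⨁ r, A r)).compLinearMap
    fun _ => DirectSum.lof R ℕ A 1)

lemma tensorMul_tprod (r : ℕ) (a : Fin r → A 1) :
    tensorMul R A r (PiTensorProduct.tprod R a) =
      (List.ofFn fun i => DirectSum.of A 1 (a i)).prod := by
  simp [tensorMul, DirectSum.lof_eq_of]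

end Defs

section Aux

variable {S : Type*} [Ring S]

lemma mul_prod_eq_zero (x : S) : ∀ {r : ℕ} (b : Fin r → S),
    (∀ i, x * b i = -(b i * x)) → (∃ j, x * b j = 0) → x * (List.ofFn b).prod = 0
  | 0, _, _, ⟨j, _⟩ => j.elim0
  | r + 1, b, hb, ⟨j, hj⟩ => by
    rw [List.ofFn_succ, List.prod_cons, ← mul_assoc]
    induction j using Fin.cases with
    | zero => rw [hj, zero_mul]
    | succ j =>
      rw [hb 0, neg_mul, mul_assoc,
        mul_prod_eq_zero x (fun i => b i.succ) (fun i => hb _) ⟨j, hj⟩, mul_zero, neg_zero]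

lemma prod_eq_zero_of_anticomm : ∀ {r : ℕ} (b : Fin r → S),
    (∀ i j, b i * b j = -(b j * b i)) → (∃ i j, i ≠ j ∧ b i * b j = 0) →
      (List.ofFn b).prod = 0
  | 0, _, _, ⟨j, _⟩ => j.elim0
  | r + 1, b, hb, ⟨i, j, hij, h⟩ => by
    rw [List.ofFn_succ, List.prod_cons]
    induction i using Fin.cases with
    | zero =>
      induction j using Fin.cases with
      | zero => exact absurd rfl hij
      | succ j => exact mul_prod_eq_zero _ _ (fun i => hb _ _) ⟨j, h⟩
    | succ i =>
      induction j using Fin.cases with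
      | zero =>
        refine mul_prod_eq_zero _ _ (fun i => hb _ _) ⟨i, ?_⟩
        rw [hb, h, neg_zero]
      | succ j =>
        rw [prod_eq_zero_of_anticomm (fun i => b i.succ) (fun _ _ => hb _ _)
          ⟨i, j, fun e => hij (by rw [e]), h⟩, mul_zero]

end Aux

section Quadratic

variable (R : Type v) [CommRing R] (A : ℕ → Type w) [∀ r, AddCommGroup (A r)]
  [∀ r, Module R (A r)] [DirectSum.GRing A] [DirectSum.GAlgebra R A]

lemma hullRel_le_ker [DegreeOneAnticomm A] (r : ℕ) :
    hullRel R A r ≤ LinearMap.ker (tensorMul R A r) := by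
  refine Submodule.span_le.2 ?_
  rintro _ ⟨a, ⟨i, j, hij, h⟩, rfl⟩
  rw [SetLike.mem_coe, LinearMap.mem_ker, tensorMul_tprod]
  refine prod_eq_zero_of_anticomm _ (fun i j => ?_) ⟨i, j, hij, ?_⟩
  · rw [DirectSum.of_mul_of, DirectSum.of_mul_of, DegreeOneAnticomm.anticomm, map_neg]
  · rw [DirectSum.of_mul_of, h, map_zero]

lemma tensorMul_mem_dec (r : ℕ) (t : ⨂[R]^r (A 1)) :
    tensorMul R A r t ∈ Subalgebra.toSubmodule (dec R A) := by
  induction t using PiTensorProduct.induction_on with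
  | smul_tprod c a =>
    rw [map_smul, tensorMul_tprod]
    refine Submodule.smul_mem _ _ (Subalgebra.list_prod_mem _ fun x hx => ?_)
    obtain ⟨i, rfl⟩ := (List.mem_ofFn' _ _).1 hx
    exact Algebra.subset_adjoin ⟨a i, rfl⟩
  | add x y hx hy => rw [map_add]; exact Submodule.add_mem _ hx hy

/-- The canonical map `ω` from the quadratic hull `⨁ r, A_1^{⊗ r} / T_r` to `A_dec`, induced by
multiplication. It is automatically multiplicative and surjective. -/
def omega [DegreeOneAnticomm A] : (⨁ r, Hull R A r) →ₗ[R] dec R A :=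
  DirectSum.toModule R ℕ (dec R A) fun r =>
    (hullRel R A r).liftQ
      ((tensorMul R A r).codRestrict (Subalgebra.toSubmodule (dec R A)) (tensorMul_mem_dec R A r))
      (by rw [LinearMap.ker_codRestrict]; exact hullRel_le_ker R A r)

/-- `A` is quadratic if `ω` is an isomorphism. -/
def IsQuadratic [DegreeOneAnticomm A] : Prop := Function.Bijective (omega R A)

end Quadratic

section Functoriality

variable {R : Type v} [CommRing R] {A B : ℕ → Type w}
  [∀ r, AddCommGroup (A r)] [∀ r, Module R (A r)] [DirectSum.GRing A] [DirectSum.GAlgebra R A]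
  [∀ r, AddCommGroup (B r)] [∀ r, Module R (B r)] [DirectSum.GRing B] [DirectSum.GAlgebra R B]

variable (R A B) in
/-- A morphism of graded `R`-algebras. -/
structure Hom where
  toFun : ∀ r, A r →ₗ[R] B r
  map_one' : toFun 0 GradedMonoid.GOne.one = GradedMonoid.GOne.one
  map_mul' : ∀ {r s} (a : A r) (b : A s),
    toFun (r + s) (GradedMonoid.GMul.mul a b) = GradedMonoid.GMul.mul (toFun r a) (toFun s b)

/-- The algebra homomorphism of total algebras given by a morphism of graded algebras. -/
def Hom.total (φ : Hom R A B) : (⨁ r, A r) →ₐ[R] ⨁ r, B r :=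
  DirectSum.toAlgebra R A (fun r => (DirectSum.lof R ℕ B r).comp (φ.toFun r))
    (by rw [LinearMap.comp_apply, φ.map_one']; rfl)
    (fun a b => by
      simp only [LinearMap.comp_apply, φ.map_mul', DirectSum.lof_eq_of, DirectSum.of_mul_of])

lemma Hom.total_of (φ : Hom R A B) (r : ℕ) (a : A r) :
    φ.total (DirectSum.of A r a) = DirectSum.of B r (φ.toFun r a) := by
  refine (DirectSum.toModule_lof R (φ := fun r => (DirectSum.lof R ℕ B r).comp (φ.toFun r)) r a).trans ?_
  rw [LinearMap.comp_apply, DirectSum.lof_eq_of]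

lemma Hom.total_mem_dec (φ : Hom R A B) (x : dec R A) : φ.total x ∈ dec R B := by
  have h : dec R A ≤ (dec R B).comap φ.total := by
    refine Algebra.adjoin_le ?_
    rintro _ ⟨a, rfl⟩
    rw [SetLike.mem_coe, Subalgebra.mem_comap, φ.total_of]
    exact Algebra.subset_adjoin ⟨_, rfl⟩
  exact h x.2

/-- The algebra homomorphism `φ_dec : A_dec → B_dec` induced by `φ`. -/
def Hom.decMap (φ : Hom R A B) : dec R A →ₐ[R] dec R B :=
  (φ.total.comp (dec R A).val).codRestrict (dec R B) φ.total_mem_dec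

end Functoriality

end GradedAlg

/-! ## The cohomology ring of a topological group with trivial coefficients -/

namespace ContCoh

/-- Continuous inhomogeneous `r`-cochains with values in the trivial module `R`. -/
abbrev Cochain (R : Type v) [CommRing R] [TopologicalSpace R] (G : Type u) [TopologicalSpace G]
    (r : ℕ) := C(Fin r → G, R)

section Cup

variable {R : Type v} [CommRing R] [TopologicalSpace R] [IsTopologicalRing R]
  {X : Type u} [TopologicalSpace X]

/-- The cup product of cochains:
`(f ∪ g)(x_1,…,x_{r+s}) = f(x_1,…,x_r) g(x_{r+1},…,x_{r+s})`. -/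
def cup {r s : ℕ} (f : Cochain R X r) (g : Cochain R X s) : Cochain R X (r + s) where
  toFun x := f (fun i => x (Fin.castAdd s i)) * g (fun j => x (Fin.natAdd r j))
  continuous_toFun := by
    refine Continuous.mul (f.continuous.comp ?_) (g.continuous.comp ?_) <;> fun_prop

lemma cup_apply {r s : ℕ} (f : Cochain R X r) (g : Cochain R X s) (x : Fin (r + s) → X) :
    cup f g x = f (fun i => x (Fin.castAdd s i)) * g (fun j => x (Fin.natAdd r j)) := rfl

end Cup

variable (R : Type v) [CommRing R] [TopologicalSpace R] [IsTopologicalRing R]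
variable (G : Type u) [Group G] [TopologicalSpace G]

variable {R G} in
lemma continuous_contractNth [IsTopologicalGroup G] {r : ℕ} (j : Fin (r + 1)) :
    Continuous fun g : Fin (r + 1) → G => Fin.contractNth j (· * ·) g := by
  refine continuous_pi fun k => ?_
  unfold Fin.contractNth
  split_ifs <;> fun_prop

variable [IsTopologicalGroup G]

/-- The inhomogeneous coboundary operator (trivial action):
`(df)(g_1,…,g_{r+1}) = f(g_2,…,g_{r+1}) + ∑_{j=1}^{r} (-1)^j f(…,g_j g_{j+1},…)
+ (-1)^{r+1} f(g_1,…,g_r)`.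
In the sum below the index `j` is shifted by one, and the summand for the last index is the last
term, as `Fin.contractNth` then simply drops the last entry. -/
def d (r : ℕ) : Cochain R G r →ₗ[R] Cochain R G (r + 1) where
  toFun f :=
    { toFun := fun g => f (fun i => g i.succ) +
        ∑ j : Fin (r + 1), (-1 : R) ^ ((j : ℕ) + 1) * f (Fin.contractNth j (· * ·) g)
      continuous_toFun := by
        refine Continuous.add (f.continuous.comp (by fun_prop)) ?_
        refine continuous_finsetSum _ fun j _ => continuous_const.mul ?_
        exact f.continuous.comp (continuous_contractNth j) }
  map_add' f g := by
    ext x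
    simp [mul_add, Finset.sum_add_distrib, add_add_add_comm]
  map_smul' c f := by
    ext x
    simp [mul_add, Finset.mul_sum, mul_left_comm]

/-- Cocycles. -/
def cocycles (r : ℕ) : Submodule R (Cochain R G r) := LinearMap.ker (d R G r)

/-- Coboundaries. -/
def coboundaries : (r : ℕ) → Submodule R (Cochain R G r)
  | 0 => ⊥
  | r + 1 => LinearMap.range (d R G r)

/-- The continuous cohomology group `H^r(G, R)`: cocycles modulo coboundaries. -/
def H (r : ℕ) := cocycles R G r ⧸ (coboundaries R G r).submoduleOf (cocycles R G r)

instance (r : ℕ) : AddCommGroup (H R G r) :=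
  inferInstanceAs (AddCommGroup (_ ⧸ (coboundaries R G r).submoduleOf (cocycles R G r)))

instance (r : ℕ) : Module R (H R G r) :=
  inferInstanceAs (Module R (_ ⧸ (coboundaries R G r).submoduleOf (cocycles R G r)))

/-- The class of a cocycle. -/
def mk (r : ℕ) : cocycles R G r →ₗ[R] H R G r :=
  ((coboundaries R G r).submoduleOf (cocycles R G r)).mkQ

variable {R G}

lemma d_apply {r : ℕ} (f : Cochain R G r) (g : Fin (r + 1) → G) :
    d R G r f g = f (fun i => g i.succ) +
        ∑ j : Fin (r + 1), (-1 : R) ^ ((j : ℕ) + 1) * f (Fin.contractNth j (· * ·) g) := rfl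

lemma mk_surjective (r : ℕ) : Function.Surjective (mk R G r) := Submodule.mkQ_surjective _

lemma mk_eq_zero {r : ℕ} {f : cocycles R G r} :
    mk R G r f = 0 ↔ (f : Cochain R G r) ∈ coboundaries R G r :=
  (Submodule.Quotient.mk_eq_zero _).trans Iff.rfl

/-- The Leibniz rule. -/
lemma d_cup {r s : ℕ} (f : Cochain R G r) (g : Cochain R G s) (x : Fin (r + s + 1) → G) :
    d R G (r + s) (cup f g) x =
      d R G r f (fun i => x ⟨i, by omega⟩) * g (fun j => x ⟨r + 1 + j, by omega⟩) +
      (-1) ^ r * (f (fun i => x ⟨i, by omega⟩) * d R G s g (fun j => x ⟨r + j, by omega⟩)) := by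
  have hsum : ∀ F : Fin (r + s + 1) → R, ∑ j, F j =
      (∑ j : Fin r, F ⟨j, by omega⟩) + ∑ k : Fin (s + 1), F ⟨r + k, by omega⟩ := fun F =>
    Fin.sum_univ_add (a := r) (b := s + 1) F
  have h1 : ∀ j : Fin r,
      cup f g (Fin.contractNth (⟨j, by omega⟩ : Fin (r + s + 1)) (· * ·) x) =
      f (Fin.contractNth j.castSucc (· * ·) (fun i : Fin (r + 1) => x ⟨i, by omega⟩)) *
        g (fun j => x ⟨r + 1 + j, by omega⟩) := by
    intro j
    rw [cup_apply]
    congr 2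
    funext k
    have : ¬ (r + (k : ℕ) < j) := by omega
    have : ¬ (r + (k : ℕ) = j) := by omega
    simp only [Fin.contractNth, Fin.val_natAdd, *, if_false]
    congr 1
    ext
    simp
    omega
  have h2 : ∀ k : Fin (s + 1),
      cup f g (Fin.contractNth (⟨r + k, by omega⟩ : Fin (r + s + 1)) (· * ·) x) =
      f (fun i => x ⟨i, by omega⟩) *
        g (Fin.contractNth k (· * ·) (fun j : Fin (s + 1) => x ⟨r + j, by omega⟩)) := by
    intro k
    rw [cup_apply]
    congr 2
    · funext i
      have : (i : ℕ) < r + k := by omega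
      simp only [Fin.contractNth, Fin.val_castAdd, this, if_true]
      rfl
    · funext i
      simp only [Fin.contractNth, Fin.val_natAdd, Nat.add_lt_add_iff_left, Nat.add_right_inj]
      rfl
  have h3 : f (Fin.contractNth (Fin.last r) (· * ·) (fun i : Fin (r + 1) => x ⟨i, by omega⟩)) =
      f (fun i => x ⟨i, by omega⟩) := by
    congr 1
    funext i
    simp only [Fin.contractNth, Fin.val_last, i.2, if_true]
    rfl
  have h4 : cup f g (fun i => x i.succ) =
      f (fun i => x ⟨i + 1, by omega⟩) * g (fun j => x ⟨r + 1 + j, by omega⟩) := by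
    rw [cup_apply]
    congr 2
    funext i
    congr 1
    ext
    simp
    omega
  have h5 : g (fun i : Fin s => x ⟨r + (i.succ : Fin (s + 1)), by omega⟩) =
      g (fun j => x ⟨r + 1 + j, by omega⟩) := by
    congr 1
    funext i
    congr 1
    ext
    simp
    omega
  rw [d_apply, d_apply, d_apply, hsum, h4, h5]
  simp only [h1, h2]
  rw [Fin.sum_univ_castSucc (n := r), h3]
  simp only [Fin.val_castSucc, Fin.val_last, Fin.val_succ, add_mul, mul_add, Finset.sum_mul,
    Finset.mul_sum, pow_add, pow_one]
  have e : ∀ a b c : R, a + b + c = a + (b + c) := add_assoc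
  generalize f (fun i => x ⟨i, by omega⟩) = F
  generalize g (fun j => x ⟨r + 1 + j, by omega⟩) = Γ
  have e1 : ∀ T : Fin (s + 1) → R, ∑ k : Fin (s + 1), (-1 : R) ^ r * (-1) ^ (k : ℕ) * -1 * (F * T k)
      = ∑ k : Fin (s + 1), (-1 : R) ^ r * (F * ((-1) ^ (k : ℕ) * -1 * T k)) := fun T =>
    Finset.sum_congr rfl fun k _ => by ring
  rw [e1]
  simp only [mul_assoc]
  ring

lemma cup_mem_cocycles {r s : ℕ} {f : Cochain R G r} {g : Cochain R G s}
    (hf : f ∈ cocycles R G r) (hg : g ∈ cocycles R G s) : cup f g ∈ cocycles R G (r + s) := by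
  refine LinearMap.mem_ker.2 (ContinuousMap.ext fun x => ?_)
  rw [d_cup, LinearMap.mem_ker.1 hf, LinearMap.mem_ker.1 hg]
  simp

/-- A cochain agreeing, up to reindexing along an equality of degrees, with a coboundary is a
coboundary. -/
lemma mem_coboundaries_of_cast {m n : ℕ} (h : n = m + 1) {f : Cochain R G n}
    (b : Cochain R G m) (hb : ∀ x : Fin (m + 1) → G, f (fun i => x (Fin.cast h i)) = d R G m b x) :
    f ∈ coboundaries R G n := by
  subst h
  exact ⟨b, ContinuousMap.ext fun x => (hb x).symm⟩

lemma cup_mem_coboundaries_left {r s : ℕ} {f : Cochain R G r} {g : Cochain R G s}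
    (hf : f ∈ coboundaries R G r) (hg : g ∈ cocycles R G s) :
    cup f g ∈ coboundaries R G (r + s) := by
  cases r with
  | zero =>
    have : f = 0 := hf
    subst this
    have : cup (0 : Cochain R G 0) g = 0 := by ext; simp [cup_apply]
    rw [this]
    exact Submodule.zero_mem _
  | succ m =>
    obtain ⟨b, rfl⟩ := hf
    refine mem_coboundaries_of_cast (Nat.add_right_comm m 1 s) (cup b g) fun x => ?_
    rw [d_cup, LinearMap.mem_ker.1 hg, cup_apply]
    simp only [ContinuousMap.zero_apply, mul_zero, add_zero]
    rfl

lemma cup_mem_coboundaries_right {r s : ℕ} {f : Cochain R G r} {g : Cochain R G s}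
    (hf : f ∈ cocycles R G r) (hg : g ∈ coboundaries R G s) :
    cup f g ∈ coboundaries R G (r + s) := by
  cases s with
  | zero =>
    have : g = 0 := hg
    subst this
    have : cup f (0 : Cochain R G 0) = 0 := ContinuousMap.ext fun x => mul_zero _
    rw [this]
    exact Submodule.zero_mem _
  | succ m =>
    obtain ⟨b, rfl⟩ := hg
    have h : d R G (r + m) (cup f b) = (-1 : R) ^ r • cup f (d R G m b) := by
      refine ContinuousMap.ext fun x => ?_
      rw [d_cup, LinearMap.mem_ker.1 hf, ContinuousMap.smul_apply, cup_apply]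
      simp only [ContinuousMap.zero_apply, zero_mul, zero_add, smul_eq_mul]
      rfl
    refine ⟨(-1 : R) ^ r • cup f b, ?_⟩
    refine (map_smul _ _ _).trans ((congrArg ((-1 : R) ^ r • ·) h).trans ?_)
    simp only [smul_smul, ← mul_pow]
    simp

variable (R G) in
/-- The cup product of cocycles, with values in cohomology. -/
def cocycleCup (r s : ℕ) : cocycles R G r →ₗ[R] cocycles R G s →ₗ[R] H R G (r + s) :=
  LinearMap.mk₂ R
    (fun f g => mk R G (r + s) ⟨cup f.1 g.1, cup_mem_cocycles f.2 g.2⟩)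
    (fun f f' g => by
      rw [← map_add]; congr 1; ext x; simp [cup_apply, add_mul])
    (fun c f g => by
      rw [← map_smul]; congr 1; ext x; simp [cup_apply, mul_assoc])
    (fun _ g g' => by
      rw [← map_add]; congr 1; ext x; simp [cup_apply, mul_add])
    (fun c f g => by
      rw [← map_smul]; congr 1; ext x; simp [cup_apply, mul_left_comm])

variable (R G) in
/-- The cup product on cohomology. -/
def cupH (r s : ℕ) : H R G r →ₗ[R] H R G s →ₗ[R] H R G (r + s) :=
  LinearMap.liftQ₂ _ _ (cocycleCup R G r s)
    (fun f hf => LinearMap.mem_ker.2 (LinearMap.ext fun g =>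
      mk_eq_zero.2 (cup_mem_coboundaries_left hf g.2)))
    (fun g hg => LinearMap.mem_ker.2 (LinearMap.ext fun f =>
      mk_eq_zero.2 (cup_mem_coboundaries_right f.2 hg)))

lemma cupH_mk {r s : ℕ} (f : cocycles R G r) (g : cocycles R G s) :
    cupH R G r s (mk R G r f) (mk R G s g) =
      mk R G (r + s) ⟨cup f.1 g.1, cup_mem_cocycles f.2 g.2⟩ := rfl

variable (R G) in
/-- Constant functions as cocycles of degree zero. -/
def scalarCocycle : R →ₗ[R] cocycles R G 0 where
  toFun c := ⟨ContinuousMap.const _ c,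
    LinearMap.mem_ker.2 (ContinuousMap.ext fun x => by simp [d_apply])⟩
  map_add' _ _ := rfl
  map_smul' _ _ := rfl

variable (R G) in
/-- Elements of `R` as classes of degree zero. -/
def ofScalar : R →ₗ[R] H R G 0 := (mk R G 0).comp (scalarCocycle R G)

instance : GradedMonoid.GOne (H R G) := ⟨ofScalar R G 1⟩

instance : GradedMonoid.GMul (H R G) := ⟨fun {r s} a b => cupH R G r s a b⟩

lemma gmk_eq {m n : ℕ} (h : m = n) (f : cocycles R G m) (g : cocycles R G n)
    (hfg : ∀ x : Fin n → G, f.1 (fun i => x (Fin.cast h i)) = g.1 x) :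
    GradedMonoid.mk (A := H R G) m (mk R G m f) = GradedMonoid.mk n (mk R G n g) := by
  subst h
  congr 2
  exact Subtype.ext (ContinuousMap.ext hfg)

lemma scalar_mul (c : R) (x : GradedMonoid (H R G)) :
    GradedMonoid.mk 0 (ofScalar R G c) * x = c • x := by
  obtain ⟨r, a⟩ := x
  obtain ⟨a, rfl⟩ := mk_surjective r a
  refine gmk_eq (Nat.zero_add r)
    ⟨cup (scalarCocycle R G c).1 a.1, cup_mem_cocycles (scalarCocycle R G c).2 a.2⟩ (c • a) ?_
  intro x
  refine congrArg (c * a.1 ·) (funext fun i => congrArg x ?_)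
  ext
  simp

lemma mul_scalar (c : R) (x : GradedMonoid (H R G)) :
    x * GradedMonoid.mk 0 (ofScalar R G c) = c • x := by
  obtain ⟨r, a⟩ := x
  obtain ⟨a, rfl⟩ := mk_surjective r a
  refine gmk_eq (Nat.add_zero r)
    ⟨cup a.1 (scalarCocycle R G c).1, cup_mem_cocycles a.2 (scalarCocycle R G c).2⟩ (c • a) ?_
  intro x
  exact mul_comm _ _

instance : DirectSum.GRing (H R G) where
  mul_zero a := map_zero _
  zero_mul a := by
    change cupH R G _ _ 0 _ = 0
    rw [map_zero, LinearMap.zero_apply]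
  mul_add a b c := map_add _ _ _
  add_mul a b c := by
    change cupH R G _ _ _ _ = _
    rw [map_add, LinearMap.add_apply]
    rfl
  one_mul x := (scalar_mul 1 x).trans (one_smul R x)
  mul_one x := (mul_scalar 1 x).trans (one_smul R x)
  mul_assoc := by
    rintro ⟨r, a⟩ ⟨s, b⟩ ⟨t, c⟩
    obtain ⟨a, rfl⟩ := mk_surjective r a
    obtain ⟨b, rfl⟩ := mk_surjective s b
    obtain ⟨c, rfl⟩ := mk_surjective t c
    refine gmk_eq (Nat.add_assoc r s t) _ _ fun x => ?_
    refine (mul_assoc _ _ _).trans ?_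
    refine congrArg (a.1 _ * ·) (congrArg (b.1 _ * ·) (congrArg c.1 (funext fun i => ?_)))
    refine congrArg x ?_
    ext
    exact Nat.add_assoc r s i
  natCast n := ofScalar R G n
  natCast_zero := by rw [Nat.cast_zero, map_zero]
  natCast_succ n := by rw [Nat.cast_succ, map_add]; rfl
  intCast n := ofScalar R G n
  intCast_ofNat n := by rw [Int.cast_natCast]
  intCast_negSucc_ofNat n := by rw [Int.cast_negSucc, map_neg]

instance : DirectSum.GAlgebra R (H R G) where
  toFun := (ofScalar R G).toAddMonoidHom
  map_one := rfl
  map_mul c c' := by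
    refine ((scalar_mul c (GradedMonoid.mk 0 (ofScalar R G c'))).trans ?_).symm
    change GradedMonoid.mk 0 (c • ofScalar R G c') = _
    rw [← map_smul]
    rfl
  commutes c x := (scalar_mul c x).trans (mul_scalar c x).symm
  smul_def c x := (scalar_mul c x).symm

lemma d_one_apply (f : Cochain R G 1) (x : Fin 2 → G) :
    d R G 1 f x = f (fun _ => x 1) - f (fun _ => x 0 * x 1) + f (fun _ => x 0) := by
  have e0 : (fun i : Fin 1 => x i.succ) = fun _ => x 1 :=
    funext fun i => by rw [Subsingleton.elim i 0]; rfl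
  have e1 : Fin.contractNth (0 : Fin 2) (· * ·) x = fun _ : Fin 1 => x 0 * x 1 :=
    funext fun i => by rw [Subsingleton.elim i 0]; rfl
  have e2 : Fin.contractNth (1 : Fin 2) (· * ·) x = fun _ : Fin 1 => x 0 :=
    funext fun i => by rw [Subsingleton.elim i 0]; rfl
  have h := Fin.sum_univ_two fun j : Fin 2 =>
    (-1 : R) ^ ((j : ℕ) + 1) * f (Fin.contractNth j (· * ·) x)
  rw [e1, e2] at h
  refine (d_apply f x).trans ?_
  refine (congrArg₂ (· + ·) (congrArg f e0) h).trans ?_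
  simp
  ring

/-- The cup product of classes of degree one is anticommutative. -/
instance : GradedAlg.DegreeOneAnticomm (H R G) where
  anticomm a b := by
    obtain ⟨a, rfl⟩ := mk_surjective 1 a
    obtain ⟨b, rfl⟩ := mk_surjective 1 b
    have hom : ∀ (f : cocycles R G 1) (x : Fin 2 → G),
        f.1 (fun _ => x 0 * x 1) = f.1 (fun _ => x 0) + f.1 (fun _ => x 1) := by
      intro f x
      have h := congrArg (fun F : Cochain R G 2 => F x) (LinearMap.mem_ker.1 f.2)
      have h' := (d_one_apply f.1 x).symm.trans h
      simp only [ContinuousMap.zero_apply] at h'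
      linear_combination -h'
    rw [eq_neg_iff_add_eq_zero]
    refine mk_eq_zero.2 ⟨-(a.1 * b.1), ContinuousMap.ext fun x => ?_⟩
    have e3 : ∀ f g : Cochain R G 1, cup f g x = f (fun _ => x 0) * g (fun _ => x 1) := by
      intro f g
      refine congrArg₂ (f · * g ·) (funext fun i => ?_) (funext fun i => ?_) <;>
      · rw [Subsingleton.elim i 0]; rfl
    change _ = cup a.1 b.1 x + cup b.1 a.1 x
    rw [e3, e3]
    refine (d_one_apply _ x).trans ?_
    simp only [ContinuousMap.neg_apply, ContinuousMap.mul_apply]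
    rw [hom a x, hom b x]
    ring

section Functoriality

variable {G' : Type u} [Group G'] [TopologicalSpace G'] [IsTopologicalGroup G']

variable (R) in
/-- Pullback of cochains along a continuous homomorphism. -/
def cochainMap (π : G →ₜ* G') (r : ℕ) : Cochain R G' r →ₗ[R] Cochain R G r where
  toFun f := ⟨fun x => f (fun i => π (x i)), f.continuous.comp (by fun_prop)⟩
  map_add' _ _ := rfl
  map_smul' _ _ := rfl

lemma cochainMap_apply (π : G →ₜ* G') {r : ℕ} (f : Cochain R G' r) (x : Fin r → G) :
    cochainMap R π r f x = f (fun i => π (x i)) := rfl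

lemma d_cochainMap (π : G →ₜ* G') {r : ℕ} (f : Cochain R G' r) :
    d R G r (cochainMap R π r f) = cochainMap R π (r + 1) (d R G' r f) := by
  ext x
  rw [cochainMap_apply, d_apply, d_apply, cochainMap_apply]
  congr 1
  refine Finset.sum_congr rfl fun j _ => ?_
  rw [cochainMap_apply]
  congr 2
  funext k
  simp only [Fin.contractNth]
  split_ifs <;> simp

lemma cochainMap_mem_cocycles (π : G →ₜ* G') {r : ℕ} {f : Cochain R G' r}
    (hf : f ∈ cocycles R G' r) : cochainMap R π r f ∈ cocycles R G r := by
  rw [cocycles, LinearMap.mem_ker, d_cochainMap, LinearMap.mem_ker.1 hf, map_zero]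

lemma cochainMap_mem_coboundaries (π : G →ₜ* G') {r : ℕ} {f : Cochain R G' r}
    (hf : f ∈ coboundaries R G' r) : cochainMap R π r f ∈ coboundaries R G r := by
  cases r with
  | zero =>
    have : f = 0 := hf
    rw [this, map_zero]
    exact Submodule.zero_mem _
  | succ m =>
    obtain ⟨b, rfl⟩ := hf
    exact ⟨cochainMap R π m b, d_cochainMap π b⟩

variable (R) in
/-- The homomorphism `π^*_r : H^r(G') → H^r(G)` induced by `π : G → G'`. -/
def mapH (π : G →ₜ* G') (r : ℕ) : H R G' r →ₗ[R] H R G r :=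
  Submodule.mapQ _ _
    ((cochainMap R π r).restrict fun _ hf => cochainMap_mem_cocycles π hf)
    (fun _ hf => cochainMap_mem_coboundaries π hf)

variable (R) in
/-- The morphism `π^* : H^*(G') → H^*(G)` of graded algebras induced by `π : G → G'`. -/
def map (π : G →ₜ* G') : GradedAlg.Hom R (H R G') (H R G) where
  toFun := mapH R π
  map_one' := rfl
  map_mul' {r s} a b := by
    obtain ⟨a, rfl⟩ := mk_surjective r a
    obtain ⟨b, rfl⟩ := mk_surjective s b
    rfl

/-- The quotient map `G → G / N` as a continuous homomorphism. -/
def quotientMap (N : Subgroup G) [N.Normal] : G →ₜ* G ⧸ N where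
  toMonoidHom := QuotientGroup.mk' N
  continuous_toFun := continuous_quotient_mk'

variable (R) in
/-- Inflation `H^*(G / N) → H^*(G)`. -/
def inflation (N : Subgroup G) [N.Normal] : GradedAlg.Hom R (H R (G ⧸ N)) (H R G) :=
  map R (quotientMap N)

end Functoriality

end ContCoh

/-! ## Subgroups of a topological group -/

section Groups

variable (G : Type u) [Group G] [TopologicalSpace G] [IsTopologicalGroup G]

/-- The descending `q`-central sequence `G^{(i,q)}`, `i = 1, 2, …`: `G^{(1,q)} = G`, and
`G^{(i+1,q)}` is the closed subgroup topologically generated by all powers `h ^ q` and all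
commutators `h⁻¹ g⁻¹ h g` with `h ∈ G^{(i,q)}`, `g ∈ G`. The index `0` is not used. -/
def descCentral (q : ℕ) : ℕ → Subgroup G
  | 0 => ⊤
  | 1 => ⊤
  | i + 2 => (Subgroup.closure
      ({x | ∃ h ∈ descCentral q (i + 1), x = h ^ q} ∪
        {x | ∃ h ∈ descCentral q (i + 1), ∃ g : G, x = h⁻¹ * g⁻¹ * h * g})).topologicalClosure

/-- The intersection of all open normal subgroups `U` of `G` such that `G / U` is a `p`-group. -/
def proPResidual (p : ℕ) : Subgroup G :=
  ⨅ (U : OpenNormalSubgroup G) (_ : IsPGroup p (G ⧸ U.toSubgroup)), U.toSubgroup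

instance (p : ℕ) : (proPResidual G p).Normal :=
  Subgroup.normal_iInf_normal fun _ => Subgroup.normal_iInf_normal fun _ => inferInstance

/-- The maximal pro-`p` quotient `G(p)` of a profinite group `G`. -/
abbrev MaxProPQuotient (p : ℕ) := G ⧸ proPResidual G p

/-- The canonical map `G → G(p)`. -/
def toMaxProPQuotient (p : ℕ) : G →* MaxProPQuotient G p := QuotientGroup.mk' _

end Groups

end

/-! Write `A` for `H^*(G/N)` and `B` for `H^*(G)`. A quadratic hull depends only on the degree one
part and on which products of two degree one elements vanish. So (a) and (b) reduce to two facts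
about inflation: it is bijective on `H^1` (`mapH_one_bijective`) and injective on the decomposable
part of `H^2` (`eq_zero_of_mapH_two_eq_zero`). They give an isomorphism of hulls in a commutative
square with the two maps `ω`; since `ω_B` is bijective and `ω_A` is surjective, everything in the
square is bijective.

Classes in `H^1` are homomorphisms to `ℤ/q`, and these kill `G^{(2)}`. A decomposable class in
`H^2(G/N)` is represented by a biadditive cocycle `F`. If `F` becomes a coboundary `dc` on `G`, then
`c(xy) = c(x) + c(y) - F(x,y)`, and `F` vanishes as soon as one argument lies in `G^{(2)}`. Hence
`c` is additive there and kills `G^{(3)}`, so it descends to `G/N` and bounds `F` already there.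

For (c), inflation is now injective on all of `H^2`, so the transgression vanishes and every
`G`-invariant homomorphism `N → ℤ/q` of the kind needed extends to `G`. The extension kills `G^{(2)}
⊇ N`. If `N` had nontrivial image in a finite `p`-quotient of `G`, that image would carry a
nontrivial invariant homomorphism, a contradiction. -/

open scoped commutatorElement

/-! ### Quadratic hulls and morphisms of graded algebras. -/

namespace GradedAlg

universe w

/-- Products of two elements of degree one span the decomposable part of degree two. -/
lemma decPart_two_le {R : Type*} [CommRing R] {A : ℕ → Type w} [∀ r, AddCommGroup (A r)]
    [∀ r, Module R (A r)] [DirectSum.GRing A] {S : Submodule R (A 2)}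
    (h : ∀ a b : A 1, (GradedMonoid.GMul.mul a b : A (1 + 1)) ∈ S) : decPart R A 2 ≤ S := by
  refine Submodule.span_le.2 ?_
  rintro x ⟨a, hx⟩
  have : x = GradedMonoid.GMul.mul (a 0) (a 1) := by
    refine DirectSum.of_injective (β := A) 2 (hx.trans ?_)
    simp only [List.ofFn_succ, List.ofFn_zero, List.prod_cons, List.prod_nil, mul_one]
    exact DirectSum.of_mul_of _ _
  rw [this]
  exact h _ _

lemma mul_mem_decPart_two {R : Type*} [CommRing R] {A : ℕ → Type w} [∀ r, AddCommGroup (A r)]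
    [∀ r, Module R (A r)] [DirectSum.GRing A] (a b : A 1) :
    (GradedMonoid.GMul.mul a b : A (1 + 1)) ∈ decPart R A 2 := by
  refine Submodule.subset_span ⟨![a, b], ?_⟩
  simp only [List.ofFn_succ, List.ofFn_zero, List.prod_cons, List.prod_nil, mul_one]
  exact (DirectSum.of_mul_of (A := A) a b).symm

/-- An isomorphism in degree one that reflects the vanishing of products identifies the relations
of the quadratic hulls. -/
lemma Hom.map_hullRel {R : Type*} [CommRing R] {A B : ℕ → Type w} [∀ r, AddCommGroup (A r)]
    [∀ r, Module R (A r)] [DirectSum.GRing A] [∀ r, AddCommGroup (B r)] [∀ r, Module R (B r)]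
    [DirectSum.GRing B] (φ : Hom R A B) (h1 : Function.Bijective (φ.toFun 1))
    (h2 : ∀ a b : A 1, φ.toFun 2 (GradedMonoid.GMul.mul a b) = 0 → GradedMonoid.GMul.mul a b = 0)
    (r : ℕ) :
    (hullRel R A r).map (PiTensorProduct.congr fun _ : Fin r =>
      LinearEquiv.ofBijective (φ.toFun 1) h1).toLinearMap = hullRel R B r := by
  rw [hullRel, hullRel, Submodule.map_span]
  congr 1
  ext t
  constructor
  · rintro ⟨_, ⟨a, ⟨i, j, hij, h⟩, rfl⟩, rfl⟩
    refine ⟨fun i => φ.toFun 1 (a i), ⟨i, j, hij, ?_⟩, PiTensorProduct.congr_tprod _ _⟩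
    rw [← φ.map_mul', h, map_zero]
  · rintro ⟨b, ⟨i, j, hij, h⟩, rfl⟩
    -- Surjectivity in degree one lifts the factors; `h2` lifts the vanishing of their product.
    choose a ha using fun i => h1.2 (b i)
    obtain rfl : (fun i => φ.toFun 1 (a i)) = b := funext ha
    refine ⟨_, ⟨a, ⟨i, j, hij, h2 _ _ ?_⟩, rfl⟩, PiTensorProduct.congr_tprod _ _⟩
    rw [← h]
    exact φ.map_mul' (r := 1) (s := 1) (a i) (a j)

variable {R : Type*} [CommRing R] {A B : ℕ → Type w}
  [∀ r, AddCommGroup (A r)] [∀ r, Module R (A r)] [DirectSum.GRing A] [DirectSum.GAlgebra R A]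
  [∀ r, AddCommGroup (B r)] [∀ r, Module R (B r)] [DirectSum.GRing B] [DirectSum.GAlgebra R B]

lemma omega_lof_mk [DegreeOneAnticomm A] (r : ℕ) (t : ⨂[R]^r (A 1)) :
    (omega R A (DirectSum.lof R ℕ (Hull R A) r (Submodule.Quotient.mk t)) : ⨁ r, A r) =
      tensorMul R A r t := by
  rw [omega, DirectSum.toModule_lof]
  rfl

variable (R A) in
-- A subalgebra generated by degree one is spanned by products of lists of degree one elements, and
-- a list of length `r` comes from a pure tensor of degree `r`.
lemma omega_surjective [DegreeOneAnticomm A] : Function.Surjective (omega R A) := by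
  have h : Subalgebra.toSubmodule (dec R A) ≤
      (LinearMap.range (omega R A)).map (Subalgebra.toSubmodule (dec R A)).subtype := by
    refine (Algebra.adjoin_eq_span R _).trans_le (Submodule.span_le.2 fun x hx => ?_)
    obtain ⟨l, hl, rfl⟩ := Submonoid.exists_list_of_mem_closure hx
    have hl' : ∀ i : Fin l.length, ∃ a : A 1, DirectSum.of A 1 a = l.get i :=
      fun i => hl _ (l.get_mem i)
    choose a ha using hl'
    refine ⟨_, ⟨DirectSum.lof R ℕ (Hull R A) l.length
      (Submodule.Quotient.mk (PiTensorProduct.tprod R a)), rfl⟩, ?_⟩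
    refine (omega_lof_mk _ _).trans ?_
    rw [tensorMul_tprod]
    simp only [ha, List.get_eq_getElem, List.ofFn_getElem]
  intro y
  obtain ⟨_, ⟨x, rfl⟩, hx⟩ := h y.2
  exact ⟨x, Subtype.ext hx⟩

/-- A morphism of graded algebras commutes with the multiplication of degree one elements. -/
lemma Hom.total_tensorMul (φ : Hom R A B) (r : ℕ) (t : ⨂[R]^r (A 1)) :
    φ.total (tensorMul R A r t) =
      tensorMul R B r (PiTensorProduct.map (fun _ => φ.toFun 1) t) := by
  induction t using PiTensorProduct.induction_on with
  | smul_tprod c a =>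
    simp only [map_smul, PiTensorProduct.map_tprod, tensorMul_tprod, map_list_prod,
      List.map_ofFn]
    congr 3
    funext i
    exact φ.total_of 1 (a i)
  | add x y hx hy => simp only [map_add, hx, hy]

/-- A morphism to a quadratic algebra which is bijective in degree one, and which reflects the
vanishing of products of two elements of degree one, is bijective on decomposable parts, and its
source is quadratic. -/
theorem Hom.isQuadratic_and_decMap_bijective [DegreeOneAnticomm A] [DegreeOneAnticomm B]
    (φ : Hom R A B) (h1 : Function.Bijective (φ.toFun 1))
    (h2 : ∀ a b : A 1, φ.toFun 2 (GradedMonoid.GMul.mul a b) = 0 → GradedMonoid.GMul.mul a b = 0)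
    (hB : IsQuadratic R B) : IsQuadratic R A ∧ Function.Bijective φ.decMap := by
  let e : ∀ r, Hull R A r ≃ₗ[R] Hull R B r := fun r =>
    Submodule.Quotient.equiv (hullRel R A r) (hullRel R B r)
      (PiTensorProduct.congr fun _ => LinearEquiv.ofBijective (φ.toFun 1) h1)
      (φ.map_hullRel h1 h2 r)
  let E : (⨁ r, Hull R A r) ≃ₗ[R] ⨁ r, Hull R B r := DFinsupp.mapRange.linearEquiv e
  have comm : ∀ x, φ.decMap (omega R A x) = omega R B (E x) := by
    intro x
    induction x using DirectSum.induction_on with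
    | zero => simp only [map_zero]
    | of r y =>
      obtain ⟨t, rfl⟩ := Submodule.Quotient.mk_surjective _ y
      have hE : E (DirectSum.of (Hull R A) r (Submodule.Quotient.mk t)) =
          DirectSum.lof R ℕ (Hull R B) r (Submodule.Quotient.mk
            (PiTensorProduct.map (fun _ => φ.toFun 1) t)) :=
        DFinsupp.mapRange_single (hf := fun r => map_zero (e r))
      rw [hE]
      refine Subtype.ext ((congrArg φ.total (omega_lof_mk r t)).trans ?_)
      rw [omega_lof_mk, φ.total_tensorMul]
    | add x y hx hy => simp only [map_add, hx, hy]
  have hcomp : Function.Bijective (φ.decMap ∘ omega R A) := by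
    have : φ.decMap ∘ omega R A = omega R B ∘ E := funext comm
    rw [this]
    exact Function.Bijective.comp hB E.bijective
  -- Only injectivity has to be read off the composite.
  have hA : Function.Bijective (omega R A) :=
    ⟨hcomp.1.of_comp, omega_surjective R A⟩
  exact ⟨hA, (Function.Bijective.of_comp_iff _ hA).1 hcomp⟩

end GradedAlg

/-! ### Invariant homomorphisms on normal subgroups of finite `p`-groups. -/

/-- A nontrivial finite `p`-group has a nontrivial homomorphism to `ℤ / p ^ d`, for `d ≥ 1`. -/
lemma IsPGroup.exists_hom_ne_one {p d : ℕ} [Fact p.Prime] (hd : 1 ≤ d) {W : Type*} [Group W]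
    [Finite W] [Nontrivial W] (hW : IsPGroup p W) :
    ∃ χ : W →* Multiplicative (ZMod (p ^ d)), χ ≠ 1 := by
  have hp : p.Prime := Fact.out
  have : NeZero (p ^ d) := ⟨pow_ne_zero _ hp.ne_zero⟩
  obtain ⟨n, hn, hcard⟩ := hW.nontrivial_iff_card.1 inferInstance
  -- A subgroup of order `p ^ (n - 1)` has index `p`, the least prime factor of the group order, and
  -- is therefore normal.
  obtain ⟨K, hK⟩ := Sylow.exists_subgroup_card_pow_prime (G := W) p (n := n - 1)
    (hcard ▸ pow_dvd_pow p (Nat.sub_le n 1))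
  have hidx : K.index = p := by
    have h := K.card_mul_index
    rw [hK, hcard] at h
    refine Nat.eq_of_mul_eq_mul_left (pow_pos hp.pos (n - 1)) (h.trans ?_)
    rw [← pow_succ, Nat.sub_add_cancel hn]
  have : K.Normal := by
    refine Subgroup.normal_of_index_eq_minFac_card ?_
    rw [hidx, hcard, hp.pow_minFac hn.ne']
  -- By Cauchy, `ℤ / p ^ d` contains a copy of the cyclic quotient `W ⧸ K`; this needs `d ≥ 1`.
  obtain ⟨z, hz⟩ := exists_prime_orderOf_dvd_card' (G := Multiplicative (ZMod (p ^ d))) p (by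
    rw [Nat.card_congr Multiplicative.toAdd, Nat.card_zmod]
    exact dvd_pow_self p (by omega))
  let e : W ⧸ K ≃* Subgroup.zpowers z :=
    mulEquivOfPrimeCardEq (p := p) hidx (by rw [Nat.card_zpowers, hz])
  refine ⟨(Subgroup.zpowers z).subtype.comp (e.toMonoidHom.comp (QuotientGroup.mk' K)), ?_⟩
  intro h
  have htop : K = ⊤ := by
    refine (Subgroup.eq_top_iff' K).2 fun x => ?_
    have hx : ((e (x : W ⧸ K) : Subgroup.zpowers z) : Multiplicative (ZMod (p ^ d))) = 1 :=
      DFunLike.congr_fun h x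
    rw [OneMemClass.coe_eq_one, map_eq_one_iff e e.injective] at hx
    exact (QuotientGroup.eq_one_iff x).1 hx
  rw [htop, Subgroup.index_top] at hidx
  exact hp.one_lt.ne hidx

/-- In a nilpotent group, a nontrivial subgroup `M` is not contained in `[M, Q]`. -/
lemma Subgroup.not_le_commutator_top {Q : Type*} [Group Q] [Group.IsNilpotent Q] {M : Subgroup Q}
    (hM : M ≠ ⊥) : ¬ M ≤ ⁅M, (⊤ : Subgroup Q)⁆ := by
  intro h
  obtain ⟨n, hn⟩ := Subgroup.nilpotent_iff_lowerCentralSeries.1 ‹Group.IsNilpotent Q›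
  have key : ∀ k, M ≤ (⊤ : Subgroup Q).lowerCentralSeries k := by
    intro k
    induction k with
    | zero => exact le_top
    | succ k ih =>
      refine h.trans ?_
      rw [Subgroup.lowerCentralSeries_succ]
      exact Subgroup.commutator_mono ih le_rfl
  exact hM (le_bot_iff.1 (hn ▸ key n))

/-- A nontrivial normal subgroup `M` of a finite `p`-group `Q` has a nontrivial `Q`-invariant
homomorphism to `ℤ / p ^ d`, for `d ≥ 1`. -/
lemma IsPGroup.exists_invariant_hom_ne_one {p d : ℕ} [Fact p.Prime] (hd : 1 ≤ d) {Q : Type*}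
    [Group Q] [Finite Q] (hQ : IsPGroup p Q) (M : Subgroup Q) [hMn : M.Normal] (hM : M ≠ ⊥) :
    ∃ χ : M →* Multiplicative (ZMod (p ^ d)), χ ≠ 1 ∧
      ∀ (g : Q) (m : M), χ ⟨g * m * g⁻¹, hMn.conj_mem m m.2 g⟩ = χ m := by
  have := hQ.isNilpotent
  have hnle := Subgroup.not_le_commutator_top hM
  -- Homomorphisms factoring through `M / [M, Q]` are automatically invariant, since `g m g⁻¹` and
  -- `m` agree modulo `[M, Q]`.
  let L : Subgroup M := ⁅M, (⊤ : Subgroup Q)⁆.subgroupOf M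
  have : L.Normal := inferInstance
  have : Nontrivial (M ⧸ L) := by
    rw [QuotientGroup.nontrivial_iff]
    intro h
    exact hnle (Subgroup.subgroupOf_eq_top.1 h)
  obtain ⟨χ, hχ⟩ := ((hQ.to_subgroup M).to_quotient L).exists_hom_ne_one hd
  refine ⟨χ.comp (QuotientGroup.mk' L), fun h => hχ ?_, fun g m => ?_⟩
  · refine QuotientGroup.monoidHom_ext _ h
  · refine congrArg χ (QuotientGroup.eq.2 ?_)
    have hc : ⁅(m : Q)⁻¹, g⁆ ∈ ⁅M, (⊤ : Subgroup Q)⁆ :=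
      Subgroup.commutator_mem_commutator (M.inv_mem m.2) (Subgroup.mem_top g)
    have he : ((⟨g * m * g⁻¹, hMn.conj_mem m m.2 g⟩⁻¹ * m : M) : Q) = (⁅(m : Q)⁻¹, g⁆)⁻¹ := by
      simp only [commutatorElement_def, Subgroup.coe_mul, Subgroup.coe_inv, mul_inv_rev, inv_inv,
        mul_assoc]
    rw [Subgroup.mem_subgroupOf, he]
    exact Subgroup.inv_mem _ hc

/-! ### The descending `q`-central sequence. -/

section DescCentral

variable {G : Type*} [Group G] [TopologicalSpace G] [IsTopologicalGroup G]

lemma descCentral_succ_le {q i : ℕ} {K : Subgroup G} (hK : IsClosed (K : Set G))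
    (hpow : ∀ h ∈ descCentral G q (i + 1), h ^ q ∈ K)
    (hcomm : ∀ h ∈ descCentral G q (i + 1), ∀ g : G, h⁻¹ * g⁻¹ * h * g ∈ K) :
    descCentral G q (i + 2) ≤ K := by
  refine Subgroup.topologicalClosure_minimal _ ((Subgroup.closure_le _).2 ?_) hK
  rintro _ (⟨h, hh, rfl⟩ | ⟨h, hh, g, rfl⟩)
  · exact hpow h hh
  · exact hcomm h hh g

lemma pow_mem_descCentral_two (q : ℕ) (h : G) : h ^ q ∈ descCentral G q 2 :=
  Subgroup.le_topologicalClosure _ (Subgroup.subset_closure (.inl ⟨h, trivial, rfl⟩))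

lemma commutator_mem_descCentral_two (q : ℕ) (h g : G) :
    h⁻¹ * g⁻¹ * h * g ∈ descCentral G q 2 :=
  Subgroup.le_topologicalClosure _ (Subgroup.subset_closure (.inr ⟨h, trivial, g, rfl⟩))

lemma isClosed_descCentral_two (q : ℕ) : IsClosed (descCentral G q 2 : Set G) :=
  Subgroup.isClosed_topologicalClosure _

lemma descCentral_three_le_two (q : ℕ) : descCentral G q 3 ≤ descCentral G q 2 :=
  descCentral_succ_le (isClosed_descCentral_two q) (fun h _ => pow_mem_descCentral_two q h)
    (fun h _ g => commutator_mem_descCentral_two q h g)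

end DescCentral

/-! ### Cochains and inflation in low degrees. -/

namespace ContCoh

universe u v

variable {R : Type v} [CommRing R] [TopologicalSpace R] [IsTopologicalRing R]
  {G : Type u} [Group G] [TopologicalSpace G] [IsTopologicalGroup G]

/-- For the trivial action the two faces cancel. Consequently `H^1` is the group of continuous
homomorphisms, with nothing divided out. -/
lemma d_zero (f : Cochain R G 0) : d R G 0 f = 0 := by
  ext x
  rw [d_apply, Fin.sum_univ_one, Subsingleton.elim (Fin.contractNth 0 (· * ·) x) fun i => x i.succ]
  simp

lemma coboundaries_one : coboundaries R G 1 = ⊥ :=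
  le_bot_iff.1 (by rintro _ ⟨f, rfl⟩; exact d_zero f)

lemma mem_cocycles_one_iff {f : Cochain R G 1} :
    f ∈ cocycles R G 1 ↔ ∀ g h : G, f (fun _ => g * h) = f (fun _ => g) + f (fun _ => h) := by
  rw [cocycles, LinearMap.mem_ker, ContinuousMap.ext_iff]
  constructor
  · intro hf g h
    have := (d_one_apply f ![g, h]).symm.trans (hf _)
    simp only [Matrix.cons_val_zero, Matrix.cons_val_one, ContinuousMap.zero_apply] at this
    linear_combination -this
  · intro hf x
    refine (d_one_apply f x).trans ?_
    rw [hf, ContinuousMap.zero_apply]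
    ring

lemma d_two_apply (f : Cochain R G 2) (x : Fin 3 → G) :
    d R G 2 f x =
      f ![x 1, x 2] - f ![x 0 * x 1, x 2] + f ![x 0, x 1 * x 2] - f ![x 0, x 1] := by
  have e : (fun i : Fin 2 => x i.succ) = ![x 1, x 2] := by ext i; fin_cases i <;> rfl
  have e0 : Fin.contractNth (0 : Fin 3) (· * ·) x = ![x 0 * x 1, x 2] := by
    ext i; fin_cases i <;> rfl
  have e1 : Fin.contractNth (1 : Fin 3) (· * ·) x = ![x 0, x 1 * x 2] := by
    ext i; fin_cases i <;> rfl
  have e2 : Fin.contractNth (2 : Fin 3) (· * ·) x = ![x 0, x 1] := by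
    ext i; fin_cases i <;> rfl
  rw [d_apply, Fin.sum_univ_three, e, e0, e1, e2]
  simp
  ring

lemma d_comp_d_one (c : Cochain R G 1) : d R G 2 (d R G 1 c) = 0 := by
  ext x
  rw [d_two_apply]
  simp only [d_one_apply, Matrix.cons_val_zero, Matrix.cons_val_one, ContinuousMap.zero_apply,
    mul_assoc]
  ring

section Quotient

variable {N : Subgroup G} [N.Normal]

/-- Openness is what makes the product map a quotient map, so that continuous cochains constant on
cosets descend continuously. -/
lemma isOpenQuotientMap_pi_quotientMap (r : ℕ) :
    IsOpenQuotientMap (Pi.map fun _ : Fin r => (quotientMap N : G → G ⧸ N)) :=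
  .piMap fun _ => QuotientGroup.isOpenQuotientMap_mk

lemma cochainMap_quotientMap_injective (r : ℕ) :
    Function.Injective (cochainMap R (quotientMap N) r) := by
  intro f f' h
  ext x
  obtain ⟨x, rfl⟩ := (isOpenQuotientMap_pi_quotientMap r).surjective x
  exact DFunLike.congr_fun h x

lemma exists_cochainMap_quotientMap_eq {r : ℕ} (f : Cochain R G r)
    (hf : ∀ x y : Fin r → G, (∀ i, (x i : G ⧸ N) = y i) → f x = f y) :
    ∃ f' : Cochain R (G ⧸ N) r, cochainMap R (quotientMap N) r f' = f := by
  have hq := (isOpenQuotientMap_pi_quotientMap (N := N) r).isQuotientMap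
  refine ⟨Topology.IsQuotientMap.lift (f := ⟨_, hq.continuous⟩) hq f
    fun x y h => hf x y (congrFun h), ContinuousMap.ext fun x => ?_⟩
  exact DFunLike.congr_fun (Topology.IsQuotientMap.lift_comp (f := ⟨_, hq.continuous⟩) hq f
    fun x y h => hf x y (congrFun h)) x

lemma exists_cochainMap_quotientMap_eq_one (c : Cochain R G 1)
    (hc : ∀ g, ∀ n ∈ N, c (fun _ => g * n) = c (fun _ => g)) :
    ∃ c' : Cochain R (G ⧸ N) 1, cochainMap R (quotientMap N) 1 c' = c := by
  refine exists_cochainMap_quotientMap_eq c fun x y h => ?_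
  have e : ∀ z : Fin 1 → G, z = fun _ => z 0 := fun z => funext fun i => by
    rw [Subsingleton.elim i 0]
  rw [e x, e y, ← hc (x 0) _ (QuotientGroup.eq.1 (h 0)), mul_inv_cancel_left]

lemma mem_cocycles_of_cochainMap_quotientMap {r : ℕ} {f : Cochain R (G ⧸ N) r}
    (hf : cochainMap R (quotientMap N) r f ∈ cocycles R G r) : f ∈ cocycles R (G ⧸ N) r := by
  refine LinearMap.mem_ker.2 (cochainMap_quotientMap_injective (r + 1) ?_)
  rw [← d_cochainMap, LinearMap.mem_ker.1 hf, map_zero]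

end Quotient

lemma mapH_mk {G' : Type u} [Group G'] [TopologicalSpace G'] [IsTopologicalGroup G']
    (π : G →ₜ* G') {r : ℕ} (f : cocycles R G' r) :
    mapH R π r (mk R G' r f) =
      mk R G r ⟨cochainMap R π r f, cochainMap_mem_cocycles π f.2⟩ := rfl

/-- A cocycle of degree one as a homomorphism. -/
def cocycleHom (f : cocycles R G 1) : G →* Multiplicative R :=
  MonoidHom.mk' (fun g => Multiplicative.ofAdd (f.1 fun _ => g))
    fun g h => congrArg Multiplicative.ofAdd (mem_cocycles_one_iff.1 f.2 g h)

lemma continuous_const_arg {r : ℕ} (f : Cochain R G r) : Continuous fun g : G => f fun _ => g :=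
  f.continuous.comp (by fun_prop)

/-- Homomorphisms to a module of exponent `q` are trivial on `G^{(2)}`. -/
lemma apply_eq_zero_of_mem_descCentral_two [T1Space R] {q : ℕ} (hq : (q : R) = 0)
    {f : Cochain R G 1} (hf : f ∈ cocycles R G 1) {n : G} (hn : n ∈ descCentral G q 2) :
    f (fun _ => n) = 0 := by
  -- The kernel is closed because points of `R` are closed; it contains `q`-th powers because `q =
  -- 0` in `R`, and commutators because the target is abelian.
  have hle : descCentral G q 2 ≤ (cocycleHom ⟨f, hf⟩).ker := by
    refine descCentral_succ_le ?_ (fun h _ => ?_) (fun h _ g => ?_)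
    · exact isClosed_singleton.preimage (continuous_const_arg f)
    · rw [MonoidHom.mem_ker, map_pow]
      refine Multiplicative.toAdd.injective ?_
      rw [toAdd_pow, nsmul_eq_mul, hq, zero_mul, toAdd_one]
    · rw [MonoidHom.mem_ker, map_mul, map_mul, map_mul, map_inv, map_inv]
      rw [mul_right_comm, inv_mul_cancel_right, inv_mul_cancel]
  exact hle hn

/-- Inflation is bijective in degree one for `N ≤ G^{(2)}`. -/
lemma mapH_one_bijective [T1Space R] {q : ℕ} (hq : (q : R) = 0) {N : Subgroup G} [N.Normal]
    (hN : N ≤ descCentral G q 2) : Function.Bijective (mapH R (quotientMap N) 1) := by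
  constructor
  · refine (injective_iff_map_eq_zero _).2 fun a ha => ?_
    obtain ⟨f, rfl⟩ := mk_surjective 1 a
    rw [mapH_mk, mk_eq_zero, coboundaries_one] at ha
    have : f = 0 := Subtype.ext (cochainMap_quotientMap_injective 1 (ha.trans (map_zero _).symm))
    rw [this, map_zero]
  · intro a
    obtain ⟨⟨f, hf⟩, rfl⟩ := mk_surjective 1 a
    obtain ⟨f', rfl⟩ := exists_cochainMap_quotientMap_eq_one (N := N) f fun g n hn => by
      rw [mem_cocycles_one_iff.1 hf, apply_eq_zero_of_mem_descCentral_two hq hf (hN hn), add_zero]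
    exact ⟨mk R _ 1 ⟨f', mem_cocycles_of_cochainMap_quotientMap hf⟩, rfl⟩

/-! ### Biadditive cochains and decomposable classes of degree two. -/

/-- Biadditive cochains of degree two. -/
structure IsBiadditive (F : Cochain R G 2) : Prop where
  mul_left : ∀ x y z, F ![x * y, z] = F ![x, z] + F ![y, z]
  mul_right : ∀ x y z, F ![x, y * z] = F ![x, y] + F ![x, z]

namespace IsBiadditive

variable {F F' : Cochain R G 2}

lemma add (hF : IsBiadditive F) (hF' : IsBiadditive F') : IsBiadditive (F + F') where
  mul_left x y z := by
    simp only [ContinuousMap.add_apply, hF.mul_left, hF'.mul_left]; ring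
  mul_right x y z := by
    simp only [ContinuousMap.add_apply, hF.mul_right, hF'.mul_right]; ring

lemma smul (hF : IsBiadditive F) (c : R) : IsBiadditive (c • F) where
  mul_left x y z := by simp only [ContinuousMap.smul_apply, hF.mul_left, smul_add]
  mul_right x y z := by simp only [ContinuousMap.smul_apply, hF.mul_right, smul_add]

lemma cup {f g : Cochain R G 1} (hf : f ∈ cocycles R G 1) (hg : g ∈ cocycles R G 1) :
    IsBiadditive (ContCoh.cup f g : Cochain R G 2) := by
  have e : ∀ x y : G, (ContCoh.cup f g : Cochain R G 2) ![x, y] =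
      f (fun _ => x) * g (fun _ => y) := fun x y =>
    congrArg₂ (f · * g ·) (funext fun i => by rw [Subsingleton.elim i 0]; rfl)
      (funext fun i => by rw [Subsingleton.elim i 0]; rfl)
  constructor <;> intro x y z
  · rw [e, e, e, mem_cocycles_one_iff.1 hf, add_mul]
  · rw [e, e, e, mem_cocycles_one_iff.1 hg, mul_add]

lemma cochainMap {G' : Type u} [Group G'] [TopologicalSpace G'] [IsTopologicalGroup G']
    (π : G' →ₜ* G) (hF : IsBiadditive F) : IsBiadditive (ContCoh.cochainMap R π 2 F) := by
  have e : ∀ x y : G', ContCoh.cochainMap R π 2 F ![x, y] = F ![π x, π y] := fun x y =>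
    congrArg F (funext fun i => by fin_cases i <;> rfl)
  constructor <;> intro x y z
  · rw [e, e, e, map_mul, hF.mul_left]
  · rw [e, e, e, map_mul, hF.mul_right]

/-- With one argument fixed, `F` is a homomorphism in the other and so kills `G^{(2)}`. -/
lemma apply_left_eq_zero [T1Space R] (hF : IsBiadditive F) {q : ℕ} (hq : (q : R) = 0) {n : G}
    (hn : n ∈ descCentral G q 2) (x : G) : F ![n, x] = 0 := by
  let f : Cochain R G 1 := ⟨fun y => F ![y 0, x], F.continuous.comp (by fun_prop)⟩
  have hf : f ∈ cocycles R G 1 := mem_cocycles_one_iff.2 fun y z => hF.mul_left y z x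
  exact apply_eq_zero_of_mem_descCentral_two hq hf hn

lemma apply_right_eq_zero [T1Space R] (hF : IsBiadditive F) {q : ℕ} (hq : (q : R) = 0) {n : G}
    (hn : n ∈ descCentral G q 2) (x : G) : F ![x, n] = 0 := by
  let f : Cochain R G 1 := ⟨fun y => F ![x, y 0], F.continuous.comp (by fun_prop)⟩
  have hf : f ∈ cocycles R G 1 := mem_cocycles_one_iff.2 fun y z => hF.mul_right x y z
  exact apply_eq_zero_of_mem_descCentral_two hq hf hn

/-- A cochain whose coboundary is biadditive is invariant under `G^{(3)}`. -/
lemma apply_mul_of_mem_descCentral_three [T1Space R] (hF : IsBiadditive F) {q : ℕ}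
    (hq : (q : R) = 0) {c : Cochain R G 1} (hc : d R G 1 c = F) (g : G) {n : G}
    (hn : n ∈ descCentral G q 3) : c (fun _ => g * n) = c (fun _ => g) := by
  have hmul : ∀ x y : G, c (fun _ => x * y) = c (fun _ => x) + c (fun _ => y) - F ![x, y] := by
    intro x y
    have := (d_one_apply c ![x, y]).symm.trans (DFunLike.congr_fun hc _)
    simp only [Matrix.cons_val_zero, Matrix.cons_val_one] at this
    linear_combination -this
  have hleft : ∀ x ∈ descCentral G q 2, ∀ y,
      c (fun _ => x * y) = c (fun _ => x) + c (fun _ => y) := fun x hx y => by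
    rw [hmul, hF.apply_left_eq_zero hq hx, sub_zero]
  have hright : ∀ x ∈ descCentral G q 2, ∀ y,
      c (fun _ => y * x) = c (fun _ => y) + c (fun _ => x) := fun x hx y => by
    rw [hmul, hF.apply_right_eq_zero hq hx, sub_zero]
  have hone : c (fun _ => (1 : G)) = 0 := by
    have := hleft 1 (Subgroup.one_mem _) 1
    rw [mul_one] at this
    exact left_eq_add.1 this
  -- The zeros of `c` in `G^{(2)}` form a subgroup because `c` is additive on products with a factor
  -- in `G^{(2)}`.
  let K : Subgroup G :=
    { carrier := {n | n ∈ descCentral G q 2 ∧ c (fun _ => n) = 0}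
      one_mem' := ⟨Subgroup.one_mem _, hone⟩
      mul_mem' := fun {x y} hx hy => ⟨Subgroup.mul_mem _ hx.1 hy.1, by
        rw [hleft x hx.1, hx.2, hy.2, add_zero]⟩
      inv_mem' := fun {x} hx => ⟨Subgroup.inv_mem _ hx.1, by
        have := hleft x hx.1 x⁻¹
        rw [mul_inv_cancel, hone, hx.2, zero_add] at this
        exact this.symm⟩ }
  have hK : descCentral G q 3 ≤ K := by
    refine descCentral_succ_le ?_ (fun h hh => ⟨pow_mem_descCentral_two q h, ?_⟩)
      (fun h hh g => ⟨commutator_mem_descCentral_two q h g, ?_⟩)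
    · exact (isClosed_descCentral_two q).inter
        (isClosed_singleton.preimage (continuous_const_arg c))
    · have hpow : ∀ m : ℕ, c (fun _ => h ^ m) = m * c (fun _ => h) := by
        intro m
        induction m with
        | zero => rw [pow_zero, hone, Nat.cast_zero, zero_mul]
        | succ m ih => rw [pow_succ, hright h hh, ih, Nat.cast_succ, add_mul, one_mul]
      rw [hpow, hq, zero_mul]
    -- Since `g h [h, g] = h g` and `c (h g) = c h + c g = c (g h)` for `h ∈ G^{(2)}`, the value of
    -- `c` at the commutator is zero.
    · have h1 := hright _ (commutator_mem_descCentral_two q h g) (g * h)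
      rw [show g * h * (h⁻¹ * g⁻¹ * h * g) = h * g by group, hleft h hh, hright h hh] at h1
      linear_combination -h1
  obtain ⟨h2, h0⟩ := hK hn
  rw [hright n h2, h0, add_zero]

end IsBiadditive

/-- Decomposable classes of degree two are represented by biadditive cocycles. -/
lemma exists_isBiadditive_of_mem_decPart {a : H R G 2}
    (ha : a ∈ GradedAlg.decPart R (H R G) 2) :
    ∃ f : cocycles R G 2, IsBiadditive f.1 ∧ mk R G 2 f = a := by
  let S : Submodule R (H R G 2) :=
    { carrier := {a | ∃ f : cocycles R G 2, IsBiadditive f.1 ∧ mk R G 2 f = a}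
      zero_mem' := ⟨0, ⟨fun _ _ _ => (add_zero 0).symm, fun _ _ _ => (add_zero 0).symm⟩,
        map_zero _⟩
      add_mem' := by
        rintro _ _ ⟨f, hf, rfl⟩ ⟨f', hf', rfl⟩
        exact ⟨f + f', hf.add hf', map_add _ _ _⟩
      smul_mem' := by
        rintro c _ ⟨f, hf, rfl⟩
        exact ⟨c • f, hf.smul c, map_smul _ _ _⟩ }
  refine GradedAlg.decPart_two_le (S := S) (fun a b => ?_) ha
  obtain ⟨f, rfl⟩ := mk_surjective 1 a
  obtain ⟨g, rfl⟩ := mk_surjective 1 b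
  exact ⟨⟨cup f.1 g.1, cup_mem_cocycles f.2 g.2⟩, .cup f.2 g.2, rfl⟩

/-- Inflation is injective on the decomposable part of degree two, for `N ≤ G^{(3)}`. -/
lemma eq_zero_of_mapH_two_eq_zero [T1Space R] {q : ℕ} (hq : (q : R) = 0) {N : Subgroup G}
    [N.Normal] (hN : N ≤ descCentral G q 3) {a : H R (G ⧸ N) 2}
    (ha : a ∈ GradedAlg.decPart R (H R (G ⧸ N)) 2) (h : mapH R (quotientMap N) 2 a = 0) :
    a = 0 := by
  obtain ⟨f, hf, rfl⟩ := exists_isBiadditive_of_mem_decPart ha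
  rw [mapH_mk, mk_eq_zero] at h
  obtain ⟨c, hc⟩ := h
  -- The bounding cochain is `N`-invariant, so it is itself inflated.
  obtain ⟨c', rfl⟩ := exists_cochainMap_quotientMap_eq_one (N := N) c fun g n hn =>
    (hf.cochainMap (quotientMap N)).apply_mul_of_mem_descCentral_three hq hc g (hN hn)
  rw [d_cochainMap] at hc
  exact mk_eq_zero.2 ⟨c', cochainMap_quotientMap_injective 2 hc⟩

/-! ### Extension of invariant homomorphisms and the maximal pro-`p` quotient. -/

/-- If inflation is injective in degree two, then `G`-invariant homomorphisms on `N` extend to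
`G`. The homomorphism is given as `n ↦ s n - s 1` for a continuous function `s` on `G`. -/
lemma exists_cocycle_extending {N : Subgroup G} [hNn : N.Normal]
    (hinj : ∀ a, mapH R (quotientMap N) 2 a = 0 → a = 0) (s : C(G, R))
    (hs : ∀ g, ∀ n ∈ N, s (g * n) = s g + (s n - s 1))
    (hinv : ∀ g, ∀ n ∈ N, s (g * n * g⁻¹) = s n) :
    ∃ f ∈ cocycles R G 1, ∀ n ∈ N, f (fun _ => n) = s n - s 1 := by
  let c : Cochain R G 1 := ⟨fun x => s (x 0), s.continuous.comp (continuous_apply 0)⟩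
  have hcs : ∀ g, c (fun _ => g) = s g := fun _ => rfl
  -- `F` represents the transgression of `s`, up to sign. Moving `n` past `x 1` conjugates it, which
  -- `hinv` absorbs, so `dc` depends only on cosets.
  obtain ⟨F, hF⟩ := exists_cochainMap_quotientMap_eq (N := N) (d R G 1 c) fun x y h => by
    have h0 : (x 0)⁻¹ * y 0 ∈ N := QuotientGroup.eq.1 (h 0)
    have h1 : (x 1)⁻¹ * y 1 ∈ N := QuotientGroup.eq.1 (h 1)
    obtain ⟨n, hn, e0⟩ : ∃ n ∈ N, y 0 = x 0 * n := ⟨_, h0, (mul_inv_cancel_left _ _).symm⟩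
    obtain ⟨m, hm, e1⟩ : ∃ m ∈ N, y 1 = x 1 * m := ⟨_, h1, (mul_inv_cancel_left _ _).symm⟩
    have hconj := hNn.conj_mem n hn (x 1)⁻¹
    have hc := hinv (x 1)⁻¹ n hn
    refine (d_one_apply c x).trans ((d_one_apply c y).trans ?_).symm
    rw [hcs, hcs, hcs, hcs, hcs, hcs, e0, e1,
      show x 0 * n * (x 1 * m) = x 0 * x 1 * ((x 1)⁻¹ * n * (x 1)⁻¹⁻¹ * m) by group,
      hs _ _ (N.mul_mem hconj hm), hs _ _ hm, hs _ _ hn, hs _ _ hm, hc]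
    ring
  have hFc : F ∈ cocycles R (G ⧸ N) 2 :=
    mem_cocycles_of_cochainMap_quotientMap (hF ▸ LinearMap.mem_ker.2 (d_comp_d_one c))
  obtain ⟨t, ht⟩ := mk_eq_zero.1 (hinj (mk R _ 2 ⟨F, hFc⟩) (mk_eq_zero.2 ⟨c, hF.symm⟩))
  have hf : c - cochainMap R (quotientMap N) 1 t ∈ cocycles R G 1 := by
    rw [cocycles, LinearMap.mem_ker, map_sub, d_cochainMap, sub_eq_zero, ← hF]
    exact congrArg _ ht.symm
  refine ⟨_, hf, fun n hn => ?_⟩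
  -- The inflation of `t` is constant on `N`; as a homomorphism vanishes at `1`, this constant is `s
  -- 1`.
  have h1 := mem_cocycles_one_iff.1 hf 1 1
  rw [mul_one, left_eq_add] at h1
  have e : ∀ g, (c - cochainMap R (quotientMap N) 1 t) (fun _ => g) =
      s g - t (fun _ => (g : G ⧸ N)) := fun _ => rfl
  rw [e] at h1 ⊢
  rw [(QuotientGroup.eq_one_iff n).2 hn]
  rw [QuotientGroup.mk_one] at h1
  linear_combination h1

end ContCoh

/-- A homomorphism `χ` on a subgroup `M` extends to a function `s` on the whole group with
`s (x * m) = s x + χ m`. -/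
lemma Subgroup.exists_function_mul_eq_add {Q A : Type*} [Group Q] [AddGroup A] (M : Subgroup Q)
    (χ : M →* Multiplicative A) :
    ∃ s : Q → A, ∀ (x : Q) (m : M), s (x * m) = s x + (χ m).toAdd := by
  -- `s` applies `χ` to the `M`-component of `x` relative to chosen coset representatives. The
  -- representative of `M` need not be `1`, so `s 1` may be nonzero.
  have hmem : ∀ x : Q, (x : Q ⧸ M).out⁻¹ * x ∈ M := fun x =>
    QuotientGroup.eq.1 (QuotientGroup.out_eq' (x : Q ⧸ M))
  refine ⟨fun x => (χ ⟨_, hmem x⟩).toAdd, fun x m => ?_⟩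
  rw [← toAdd_mul, ← map_mul]
  refine congrArg (fun y => (χ y).toAdd) (Subtype.ext ?_)
  have h : ((x * m : Q) : Q ⧸ M) = x := QuotientGroup.mk_mul_of_mem x m.2
  simp only [h, Subgroup.coe_mul, mul_assoc]

/-- If inflation is injective in degree two and `N ≤ G^{(2)}`, then `N` is contained in the kernel
of the canonical map to the maximal pro-`p` quotient. -/
lemma le_proPResidual_of_mapH_two_injective {p d : ℕ} (hp : p.Prime) (hd : 1 ≤ d) {G : Type*}
    [Group G] [TopologicalSpace G] [IsTopologicalGroup G] [CompactSpace G] {N : Subgroup G}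
    [hNn : N.Normal] (hN : N ≤ descCentral G (p ^ d) 2)
    (hinj : ∀ a, ContCoh.mapH (ZMod (p ^ d)) (ContCoh.quotientMap N) 2 a = 0 → a = 0) :
    N ≤ proPResidual G p := by
  have : Fact p.Prime := ⟨hp⟩
  refine le_iInf₂ fun U hU => ?_
  by_contra hNU
  have hdisc : DiscreteTopology (G ⧸ U.toSubgroup) := QuotientGroup.discreteTopology U.isOpen
  have hfin : Finite (G ⧸ U.toSubgroup) := finite_of_compact_of_discrete
  let π := QuotientGroup.mk' U.toSubgroup
  let M : Subgroup (G ⧸ U.toSubgroup) := N.map π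
  have hMn : M.Normal := hNn.map π (QuotientGroup.mk'_surjective _)
  -- The image of `N` in the finite `p`-group `G ⧸ U` is nontrivial exactly because `N` is not
  -- contained in `U`.
  have hM : M ≠ ⊥ := by
    rwa [Ne, Subgroup.map_eq_bot_iff, QuotientGroup.ker_mk']
  obtain ⟨χ, hχ, hinv⟩ := hU.exists_invariant_hom_ne_one hd M hM
  obtain ⟨s, hs⟩ := M.exists_function_mul_eq_add χ
  have hs1 : ∀ m : M, s m = s 1 + (χ m).toAdd := fun m => by rw [← hs, one_mul]
  obtain ⟨f, hf, hfs⟩ := ContCoh.exists_cocycle_extending hinj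
    ⟨fun g => s (π g), continuous_of_discreteTopology.comp QuotientGroup.continuous_mk⟩
    (fun g n hn => by
      have h := hs (π g) ⟨π n, Subgroup.mem_map_of_mem π hn⟩
      have h1 := hs1 ⟨π n, Subgroup.mem_map_of_mem π hn⟩
      simp only [ContinuousMap.coe_mk, map_mul, map_one, h, h1]
      ring)
    (fun g n hn => by
      have h1 := hs1 ⟨π n, Subgroup.mem_map_of_mem π hn⟩
      rw [← hinv (π g), ← hs1] at h1
      simpa only [ContinuousMap.coe_mk, map_mul, map_inv] using h1.symm)
  -- On `N` the extension `f` is `χ ∘ π`, yet it vanishes there since `N ≤ G^{(2)}`; so `χ` is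
  -- trivial.
  refine hχ (MonoidHom.ext ?_)
  rintro ⟨_, n, hn, rfl⟩
  have h0 := hfs n hn
  rw [ContCoh.apply_eq_zero_of_mem_descCentral_two (ZMod.natCast_self _) hf (hN hn)] at h0
  have h1 := hs1 ⟨π n, Subgroup.mem_map_of_mem π hn⟩
  simp only [ContinuousMap.coe_mk, map_one] at h0
  refine Multiplicative.toAdd.injective ?_
  rw [MonoidHom.one_apply, toAdd_one]
  linear_combination -h0 - h1

theorem theorem6p6 (p d : ℕ) (hp : p.Prime) (hd : 1 ≤ d)
    (G : Type*) [Group G] [TopologicalSpace G] [IsTopologicalGroup G]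
    [CompactSpace G] [T2Space G] [TotallyDisconnectedSpace G]
    (hG : GradedAlg.IsQuadratic (ZMod (p ^ d)) (ContCoh.H (ZMod (p ^ d)) G))
    (N : Subgroup G) [N.Normal] (hNclosed : IsClosed (N : Set G))
    (hN : N ≤ descCentral G (p ^ d) 3) :
    Function.Bijective (ContCoh.inflation (ZMod (p ^ d)) N).decMap ∧
    GradedAlg.IsQuadratic (ZMod (p ^ d)) (ContCoh.H (ZMod (p ^ d)) (G ⧸ N)) ∧
    (GradedAlg.IsDecomposable (ZMod (p ^ d)) (ContCoh.H (ZMod (p ^ d)) (G ⧸ N)) 2 →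
      N ≤ (toMaxProPQuotient G p).ker) := by

  have hq : ((p ^ d : ℕ) : ZMod (p ^ d)) = 0 := ZMod.natCast_self _
  have hN2 := hN.trans (descCentral_three_le_two _)
  obtain ⟨hquad, hdec⟩ := (ContCoh.inflation (ZMod (p ^ d)) N).isQuadratic_and_decMap_bijective
    (ContCoh.mapH_one_bijective hq hN2) (fun a b h =>
      ContCoh.eq_zero_of_mapH_two_eq_zero hq hN (GradedAlg.mul_mem_decPart_two a b) h) hG
  refine ⟨hdec, hquad, fun htop => ?_⟩
  rw [toMaxProPQuotient, QuotientGroup.ker_mk']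
  -- When `H^2(G/N)` is decomposable, injectivity on the decomposable part is injectivity on all of
  -- it.
  exact le_proPResidual_of_mapH_two_injective hp hd hN2 fun a =>
    ContCoh.eq_zero_of_mapH_two_eq_zero hq hN (htop ▸ Submodule.mem_top)
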